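/- **Definitions.** Let $I\subseteq\mathbb R$ be an interval and $m\ge 1$ an integer. A real function $f$ on $I$ is *$m$-monotone* on $I$ if $A\le B$ implies $f(A)\le f(B)$ for all selfadjoint complex $m\times m$ matrices $A,B$ whose eigenvalues lie in $I$. It is *$m$-convex* on $I$ if $f(cA+(1-c)B)\le c\,f(A)+(1-c)f(B)$ for all $c\in[0,1]$ and all such $A,B$. Here $f(A)$ is the functional calculus and $\le$ is the order given by positive semidefiniteness of the difference. A Hermitian $n\times n$ matrix $A$ is *conditionally positive definite* if $\langle x,Ax\rangle\ge 0$ for every $x\in\mathbb C^n$ with $\sum_i x_i=0$. For $n\ge 2$, $Q_n(I)$ is the class of real $C^1$ functions $f$ on $I$ such that for all (not necessarily distinct) $\lambda_1,\dots,\lambda_n\in I$ the Loewner matrix $([\lambda_i,\lambda_j]_f)_{i,j=1}^n$ is conditionally positive definite, where $[s,t]_f=\frac{f(s)-f(t)}{s-t}$ for $s\ne t$ and $[s,s]_f=f'(s)$ (one-sided at an endpoint that belongs to $I$). **Theorem.** Let $n\ge 2$, $0<\alpha\le\infty$ and $f\in Q_n([0,\alpha))$. If $\frac{f(t)-f(0)}{t}$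 is $(n-1)$-monotone on $(0,\alpha)$, then $f$ is $(n-1)$-convex on $[0,\alpha)$. In particular, if $f(0)=0$ and $\frac{f(t)}{t}$ is $(n-1)$-monotone on $(0,\alpha)$, then $f$ is $(n-1)$-convex on $[0,\alpha)$. -/

import Mathlib

open scoped ComplexOrder

/-- The interval `[0, α)` of the real line, for `α ∈ (0, ∞]`. -/
def leftClosedInterval (α : EReal) : Set ℝ := {t : ℝ | 0 ≤ t ∧ (t : EReal) < α}

/-- The open interval `(0, α)` of the real line, for `α ∈ (0, ∞]`. -/
def openInterval (α : EReal) : Set ℝ := {t : ℝ | 0 < t ∧ (t : EReal) < α}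

/-- `f` is `n`-monotone on `I`: `A ≤ B` implies `f(A) ≤ f(B)` for all selfadjoint complex
`n × n` matrices `A`, `B` whose eigenvalues lie in `I`. Here `cfc f A` is the functional
calculus `f(A)`, and `A ≤ B` means that `B - A` is positive semidefinite. -/
def IsMatrixMonotone (n : ℕ) (I : Set ℝ) (f : ℝ → ℝ) : Prop :=
  ∀ A B : Matrix (Fin n) (Fin n) ℂ, A.IsHermitian → B.IsHermitian →
    spectrum ℝ A ⊆ I → spectrum ℝ B ⊆ I →
    (B - A).PosSemidef → (cfc f B - cfc f A).PosSemidef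

/-- `f` is `n`-convex on `I`: `f(c A + (1 - c) B) ≤ c f(A) + (1 - c) f(B)` for all `c ∈ [0, 1]`
and all selfadjoint complex `n × n` matrices `A`, `B` whose eigenvalues lie in `I`. -/
def IsMatrixConvex (n : ℕ) (I : Set ℝ) (f : ℝ → ℝ) : Prop :=
  ∀ A B : Matrix (Fin n) (Fin n) ℂ, A.IsHermitian → B.IsHermitian →
    spectrum ℝ A ⊆ I → spectrum ℝ B ⊆ I →
    ∀ c : ℝ, 0 ≤ c → c ≤ 1 →
      (c • cfc f A + (1 - c) • cfc f B - cfc f (c • A + (1 - c) • B)).PosSemidef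

/-- A Hermitian matrix `A` is conditionally positive definite if `⟨x, A x⟩ ≥ 0` for all
complex vectors `x` whose coordinates sum to zero. -/
def IsCondPosDef {n : ℕ} (A : Matrix (Fin n) (Fin n) ℂ) : Prop :=
  A.IsHermitian ∧
    ∀ x : Fin n → ℂ, ∑ i, x i = 0 → 0 ≤ (dotProduct (star x) (A.mulVec x)).re

open Classical in
/-- The first divided difference `[s, t]_f` of a function on `I`, which is `f'(s)` if `s = t`
(a one-sided derivative at an endpoint that belongs to `I`). -/
noncomputable def dividedDiff (I : Set ℝ) (f : ℝ → ℝ) (s t : ℝ) : ℝ :=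
  if s = t then derivWithin f I s else (f s - f t) / (s - t)

/-- The Loewner matrix `([l i, l j]_f)` as a complex matrix. -/
noncomputable def loewnerMatrix {n : ℕ} (I : Set ℝ) (f : ℝ → ℝ) (l : Fin n → ℝ) :
    Matrix (Fin n) (Fin n) ℂ :=
  Matrix.of fun i j => ((dividedDiff I f (l i) (l j) : ℝ) : ℂ)

/-- The class `Q_n(I)`: real `C¹` functions on `I` all of whose `n × n` Loewner matrices are
conditionally positive definite. The points `l i` need not be distinct. -/
def classQ (n : ℕ) (I : Set ℝ) : Set (ℝ → ℝ) :=
  {f | ContDiffOn ℝ 1 f I ∧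
    ∀ l : Fin n → ℝ, (∀ i, l i ∈ I) → IsCondPosDef (loewnerMatrix I f l)}

/-!
By Newton's formula the error at `μ` of the linear interpolation of `f` at `s` and `t` is
`(μ - s) (μ - t) [s, t, μ]_f`. Compare `f(A)` and `f(B)` with `f(C)`, `C = c A + (1 - c) B`, in an
eigenbasis of `C` with eigenvalues `s i`: the first order terms cancel, so convexity follows once
the matrices of interpolation errors are positive semidefinite, i.e. once the quadratic forms of
`([s i, s j, μ]_f)` are nonnegative.

Conditional positivity of the Loewner matrices makes these forms nondecreasing in `μ`: away from
the nodes the derivative of `∑ x i x j [s i, s j, μ]_f` is the form of the Loewner matrix of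
`s 1, …, s m, μ` at a vector with coordinate sum zero, and across a node the jump is nonnegative
by the inequality `f'(c) ≤ [c + h, c - h]_f`. At `μ = 0` the form is nonnegative by Loewner's
theorem, since `[s, t, 0]_f` is the first divided difference of `(f(t) - f(0)) / t`.
-/

open Set Filter Matrix
open scoped Topology Matrix.Norms.L2Operator

section SelfAdjoint

variable {E : Type*} [AddCommGroup E] [Module ℝ E]

theorem tendsto_add_smul_nhdsGT_zero [TopologicalSpace E] [ContinuousAdd E] [ContinuousSMul ℝ E]
    (a h : E) : Tendsto (fun t : ℝ => a + t • h) (𝓝[>] 0) (𝓝 a) := by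
  have hcont : Continuous fun t : ℝ => a + t • h := by fun_prop
  simpa only [zero_smul, add_zero] using (hcont.tendsto 0).mono_left nhdsWithin_le_nhds

variable [StarAddMonoid E] [StarModule ℝ E] {a b : E}

theorem isSelfAdjoint_add_real_smul (ha : IsSelfAdjoint a) (hb : IsSelfAdjoint b) (t : ℝ) :
    IsSelfAdjoint (a + t • b) :=
  ha.add ((IsSelfAdjoint.all t).smul hb)

theorem isSelfAdjoint_convexComb (ha : IsSelfAdjoint a) (hb : IsSelfAdjoint b) (c : ℝ) :
    IsSelfAdjoint (c • a + (1 - c) • b) :=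
  isSelfAdjoint_add_real_smul ((IsSelfAdjoint.all c).smul ha) hb (1 - c)

end SelfAdjoint

section CStarAlgebra

variable {𝓐 : Type*} [CStarAlgebra 𝓐] {a b : 𝓐} {J : Set ℝ} {f : ℝ → ℝ}

theorem eventually_spectrum_real_subset {K : Set ℝ} (hK : K ∈ 𝓝ˢ (spectrum ℝ a)) :
    ∀ᶠ b in 𝓝 a, spectrum ℝ b ⊆ K :=
  ((upperHemicontinuous_spectrum ℝ 𝓐).upperHemicontinuousAt a K hK).mono
    fun _ => subset_of_mem_nhdsSet

theorem tendsto_cfc_of_isOpen {X : Type*} {l : Filter X} {b : X → 𝓐} (ha : IsSelfAdjoint a)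
    (hb : ∀ x, IsSelfAdjoint (b x)) (hba : Tendsto b l (𝓝 a)) (hJ : IsOpen J)
    (haJ : spectrum ℝ a ⊆ J) (hf : ContinuousOn f J) :
    Tendsto (fun x => cfc f (b x)) l (𝓝 (cfc f a)) := by
  obtain ⟨K, ⟨haK, hK⟩, hKJ⟩ :=
    (spectrum.isCompact (𝕜 := ℝ) a).nhdsSet_basis_isCompact.mem_iff.1 (hJ.mem_nhdsSet.2 haJ)
  exact hba.cfc hK f (hba.eventually (eventually_spectrum_real_subset haK)) (.of_forall hb)
    (subset_of_mem_nhdsSet haK) ha (hf.mono hKJ)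

theorem spectrum_real_convexComb_subset_Icc (ha : IsSelfAdjoint a) (hb : IsSelfAdjoint b)
    {r s : ℝ} (hars : spectrum ℝ a ⊆ Icc r s) (hbrs : spectrum ℝ b ⊆ Icc r s) {c : ℝ}
    (hc0 : 0 ≤ c) (hc1 : c ≤ 1) : spectrum ℝ (c • a + (1 - c) • b) ⊆ Icc r s := by
  let := CStarAlgebra.spectralOrder 𝓐
  let := CStarAlgebra.spectralOrderedRing 𝓐
  have hab := isSelfAdjoint_convexComb ha hb c
  have hlower := convex_Ici (𝕜 := ℝ) (algebraMap ℝ 𝓐 r)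
    ((algebraMap_le_iff_le_spectrum ha).2 fun x hx => (hars hx).1)
    ((algebraMap_le_iff_le_spectrum hb).2 fun x hx => (hbrs hx).1)
    hc0 (sub_nonneg.2 hc1) (add_sub_cancel c 1)
  have hupper := convex_Iic (𝕜 := ℝ) (algebraMap ℝ 𝓐 s)
    ((le_algebraMap_iff_spectrum_le ha).2 fun x hx => (hars hx).2)
    ((le_algebraMap_iff_spectrum_le hb).2 fun x hx => (hbrs hx).2)
    hc0 (sub_nonneg.2 hc1) (add_sub_cancel c 1)
  exact fun x hx => ⟨(algebraMap_le_iff_le_spectrum hab).1 hlower x hx,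
    (le_algebraMap_iff_spectrum_le hab).1 hupper x hx⟩

theorem spectrum_real_convexComb_subset (ha : IsSelfAdjoint a) (hb : IsSelfAdjoint b)
    (hJ : J.OrdConnected) (haJ : spectrum ℝ a ⊆ J) (hbJ : spectrum ℝ b ⊆ J) {c : ℝ}
    (hc0 : 0 ≤ c) (hc1 : c ≤ 1) : spectrum ℝ (c • a + (1 - c) • b) ⊆ J := by
  cases subsingleton_or_nontrivial 𝓐
  · rw [spectrum.of_subsingleton]
    exact empty_subset J
  have hcompact := (spectrum.isCompact (𝕜 := ℝ) a).union (spectrum.isCompact (𝕜 := ℝ) b)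
  have hne : (spectrum ℝ a ∪ spectrum ℝ b).Nonempty :=
    (ContinuousFunctionalCalculus.spectrum_nonempty a ha).inl
  obtain ⟨r, hr, hmin⟩ := hcompact.exists_isLeast hne
  obtain ⟨s, hs, hmax⟩ := hcompact.exists_isGreatest hne
  exact (spectrum_real_convexComb_subset_Icc ha hb
    (fun x hx => ⟨hmin (.inl hx), hmax (.inl hx)⟩) (fun x hx => ⟨hmin (.inr hx), hmax (.inr hx)⟩)
    hc0 hc1).trans (hJ.out (union_subset haJ hbJ hr) (union_subset haJ hbJ hs))

end CStarAlgebra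

section MatrixFunctionalCalculus

variable {ι 𝕜 : Type*} [RCLike 𝕜]

theorem isHermitian_diagonal_ofReal [DecidableEq ι] (s : ι → ℝ) :
    (diagonal fun i => (s i : 𝕜)).IsHermitian :=
  isHermitian_diagonal_of_self_adjoint _ (funext fun i => RCLike.conj_ofReal (s i))

theorem posSemidef_map_ofReal [Finite ι] {M : Matrix ι ι ℝ} (hM : M.PosSemidef) :
    (M.map ((↑) : ℝ → 𝕜)).PosSemidef := by
  cases nonempty_fintype ι
  obtain ⟨m, v, rfl⟩ := posSemidef_iff_eq_sum_vecMulVec.1 hM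
  have hmap : (∑ k, vecMulVec (v k) (star (v k))).map ((↑) : ℝ → 𝕜) =
      ∑ k, vecMulVec (fun i => (v k i : 𝕜)) (star fun i => (v k i : 𝕜)) := by
    ext i j
    simp [Matrix.sum_apply, vecMulVec_apply]
  rw [hmap]
  exact posSemidef_sum _ fun k _ => posSemidef_vecMulVec_self_star _

variable [Fintype ι] [DecidableEq ι]

theorem continuousOn_real_spectrum (f : ℝ → ℝ) (A : Matrix ι ι 𝕜) :
    ContinuousOn f (spectrum ℝ A) :=
  finite_real_spectrum.continuousOn f

theorem cfc_sub_smul_one_eq_mul {A : Matrix ι ι 𝕜} (hA : A.IsHermitian) {f g : ℝ → ℝ} {s : ℝ}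
    (h : ∀ b, f b - f s = (b - s) * g b) :
    cfc f A - f s • 1 = (A - s • 1) * cfc g A := by
  have hA' : IsSelfAdjoint A := hA
  have hc := fun u : ℝ → ℝ => continuousOn_real_spectrum u A
  have hs : ∀ r : ℝ, (r • 1 : Matrix ι ι 𝕜) = cfc (fun _ => r) A := fun r => by
    rw [cfc_const r A, Algebra.algebraMap_eq_smul_one]
  conv_rhs => enter [1, 1]; rw [← cfc_id' ℝ A]
  rw [hs, hs, ← cfc_sub _ _ A (hc _) (hc _), ← cfc_sub _ _ A (hc _) (hc _),
    ← cfc_mul _ _ A (hc _) (hc _)]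
  simp only [h]

theorem posSemidef_of_cfc_apply {A : Matrix ι ι 𝕜} (hA : A.IsHermitian) {K : ℝ → Matrix ι ι ℝ}
    (hK : ∀ b ∈ spectrum ℝ A, ((K b).map ((↑) : ℝ → 𝕜)).PosSemidef) :
    (Matrix.of fun i j => cfc (fun b => K b i j) A i j).PosSemidef := by
  let V : Matrix ι ι 𝕜 := hA.eigenvectorUnitary.1
  have hsum : (Matrix.of fun i j => cfc (fun b => K b i j) A i j) =
      ∑ k, (vecMulVec (fun i => V i k) (star fun i => V i k)).hadamard
        ((K (hA.eigenvalues k)).map ((↑) : ℝ → 𝕜)) := by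
    ext i j
    rw [Matrix.of_apply, hA.cfc_eq, Matrix.sum_apply, IsHermitian.cfc,
      Unitary.conjStarAlgAut_apply, mul_apply]
    refine Finset.sum_congr rfl fun k _ => ?_
    simp only [mul_diagonal, IsHermitian.eigenvectorUnitary_apply, Function.comp_apply,
      star_apply, RCLike.star_def, hadamard_apply, vecMulVec_apply, Pi.star_apply, map_apply, V]
    ring
  rw [hsum]
  refine posSemidef_sum _ fun k _ => (posSemidef_vecMulVec_self_star _).hadamard (hK _ ?_)
  rw [hA.spectrum_real_eq_range_eigenvalues]
  exact mem_range_self k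

theorem cfc_sub_diagonal_apply {A : Matrix ι ι 𝕜} (hA : A.IsHermitian) {f g : ℝ → ℝ} {s : ι → ℝ}
    (i : ι) (h : ∀ b, f b - f (s i) = (b - s i) * g b) (j : ι) :
    (cfc f A - diagonal fun i => (f (s i) : 𝕜)) i j =
      ((A - diagonal fun i => (s i : 𝕜)) * cfc g A) i j := by
  have key := congr_fun (congr_fun (cfc_sub_smul_one_eq_mul hA h) i) j
  simp only [sub_mul, Matrix.sub_apply, smul_mul_assoc, one_mul, Matrix.smul_apply, diagonal_apply,
    diagonal_mul, one_apply, RCLike.real_smul_eq_coe_mul, mul_ite, mul_one, mul_zero] at key ⊢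
  exact key

theorem spectrum_real_diagonal_ofReal (s : ι → ℝ) :
    spectrum ℝ (diagonal fun i => (s i : 𝕜)) = range s := by
  rw [← spectrum.preimage_algebraMap 𝕜, spectrum_diagonal, RCLike.algebraMap_eq_ofReal]
  ext b
  simp

theorem cfc_diagonal (f : ℝ → ℝ) (s : ι → ℝ) :
    cfc f (diagonal fun i => (s i : 𝕜)) = diagonal fun i => (f (s i) : 𝕜) := by
  ext i j
  have h := cfc_sub_diagonal_apply (isHermitian_diagonal_ofReal (𝕜 := 𝕜) s) (f := f) i
    (fun b => (sub_smul_dslope f (s i) b).symm) j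
  simpa [sub_eq_zero] using h

end MatrixFunctionalCalculus

section DividedDifferences

variable {J : Set ℝ} {f : ℝ → ℝ} {s t : ℝ}

theorem dividedDiff_comm (J : Set ℝ) (f : ℝ → ℝ) (s t : ℝ) :
    dividedDiff J f s t = dividedDiff J f t s := by
  rcases eq_or_ne s t with rfl | h
  · rfl
  · rw [dividedDiff, dividedDiff, if_neg h, if_neg h.symm, ← neg_sub (f t), ← neg_sub t,
      neg_div_neg_eq]

theorem dividedDiff_mul_sub (J : Set ℝ) (f : ℝ → ℝ) (s t : ℝ) :
    dividedDiff J f s t * (s - t) = f s - f t := by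
  rcases eq_or_ne s t with rfl | h
  · simp
  · rw [dividedDiff, if_neg h, div_mul_cancel₀ _ (sub_ne_zero.2 h)]

theorem dividedDiff_eq_dslope (hJ : IsOpen J) (hs : s ∈ J) (t : ℝ) :
    dividedDiff J f s t = dslope f s t := by
  rcases eq_or_ne t s with rfl | h
  · rw [dividedDiff, if_pos rfl, dslope_same, derivWithin_of_isOpen hJ hs]
  · rw [dividedDiff_comm, dividedDiff, if_neg h, dslope_of_ne _ h, slope_def_field]

end DividedDifferences

section Loewner

variable {ι : Type*} {J : Set ℝ} {f : ℝ → ℝ} {s : ι → ℝ}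

theorem isClosed_setOf_posSemidef [Finite ι] : IsClosed {A : Matrix ι ι ℂ | A.PosSemidef} := by
  classical
  cases nonempty_fintype ι
  open scoped MatrixOrder in
  simpa only [nonneg_iff_posSemidef] using CStarAlgebra.isClosed_nonneg (A := Matrix ι ι ℂ)

variable [Fintype ι] [DecidableEq ι]

theorem tendsto_inv_smul_cfc_diagonal_add_smul_sub_apply {H : Matrix ι ι ℂ} (hH : H.IsHermitian)
    (hJ : IsOpen J) (hf : DifferentiableOn ℝ f J) (hs : ∀ i, s i ∈ J) (i j : ι) :
    Tendsto (fun t : ℝ => (t⁻¹ • (cfc f ((diagonal fun i => (s i : ℂ)) + t • H) -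
      cfc f (diagonal fun i => (s i : ℂ)))) i j) (𝓝[>] 0)
      (𝓝 (H i j * (dividedDiff J f (s i) (s j) : ℝ))) := by
  set A : Matrix ι ι ℂ := diagonal fun i => (s i : ℂ)
  have hA : A.IsHermitian := isHermitian_diagonal_ofReal s
  have hAJ : spectrum ℝ A ⊆ J := (spectrum_real_diagonal_ofReal s).trans_subset
    (range_subset_iff.2 hs)
  have hcfc : ∀ g : ℝ → ℝ, cfc g A = diagonal fun i => (g (s i) : ℂ) := fun g => cfc_diagonal g s
  have hdslope : ContinuousOn (dslope f (s i)) J :=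
    (continuousOn_dslope (hJ.mem_nhds (hs i))).2
      ⟨hf.continuousOn, hf.differentiableAt (hJ.mem_nhds (hs i))⟩
  have hlim := (tendsto_const_nhds (x := H)).mul (tendsto_cfc_of_isOpen hA
    (isSelfAdjoint_add_real_smul hA hH) (tendsto_add_smul_nhdsGT_zero A H) hJ hAJ hdslope)
  rw [hcfc] at hlim
  have hlim_apply := (hlim.apply_nhds i).apply_nhds j
  rw [mul_diagonal, ← dividedDiff_eq_dslope hJ (hs i)] at hlim_apply
  refine hlim_apply.congr' ?_
  filter_upwards [self_mem_nhdsWithin] with t ht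
  -- Row `i` of the increment is exact, since `f b - f (s i) = (b - s i) * dslope f (s i) b`.
  have hrow : (cfc f (A + t • H) - diagonal fun i => (f (s i) : ℂ)) i j =
      ((A + t • H - A) * cfc (dslope f (s i)) (A + t • H)) i j :=
    cfc_sub_diagonal_apply (isSelfAdjoint_add_real_smul hA hH t) i
      (fun b => (sub_smul_dslope f (s i) b).symm) j
  rw [Matrix.smul_apply, hcfc, hrow, add_sub_cancel_left, smul_mul_assoc,
    Matrix.smul_apply, inv_smul_smul₀ (ne_of_gt ht)]

theorem IsMatrixMonotone.posSemidef_loewnerMatrix {n : ℕ} {s : Fin n → ℝ} (hJ : IsOpen J)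
    (hf : DifferentiableOn ℝ f J) (hmono : IsMatrixMonotone n J f) (hs : ∀ i, s i ∈ J) :
    (loewnerMatrix J f s).PosSemidef := by
  set A : Matrix (Fin n) (Fin n) ℂ := diagonal fun i => (s i : ℂ)
  set H : Matrix (Fin n) (Fin n) ℂ := vecMulVec 1 (star 1)
  have hA : A.IsHermitian := isHermitian_diagonal_ofReal s
  have hAJ : spectrum ℝ A ⊆ J := (spectrum_real_diagonal_ofReal s).trans_subset
    (range_subset_iff.2 hs)
  have hH : H.PosSemidef := posSemidef_vecMulVec_self_star _
  have hlim : Tendsto (fun t : ℝ => t⁻¹ • (cfc f (A + t • H) - cfc f A)) (𝓝[>] 0)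
      (𝓝 (loewnerMatrix J f s)) :=
    tendsto_pi_nhds.2 fun i => tendsto_pi_nhds.2 fun j => by
      simpa [H, loewnerMatrix, vecMulVec_apply] using
        tendsto_inv_smul_cfc_diagonal_add_smul_sub_apply hH.isHermitian hJ hf hs i j
  refine isClosed_setOf_posSemidef.mem_of_tendsto hlim ?_
  filter_upwards [self_mem_nhdsWithin,
    (tendsto_add_smul_nhdsGT_zero A H).eventually
      (eventually_spectrum_real_subset (hJ.mem_nhdsSet.2 hAJ))] with t ht htJ
  have ht : 0 < t := ht
  refine (hmono _ _ hA (isSelfAdjoint_add_real_smul hA hH.isHermitian t) hAJ htJ ?_).smul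
    (inv_pos.2 ht).le
  rw [add_sub_cancel_left]
  exact hH.smul ht.le

end Loewner

section Interpolation

variable {J : Set ℝ} {f : ℝ → ℝ} {n : ℕ}

/-- The error at `μ` of the linear interpolation of `f` at the nodes `s` and `t`. By Newton's
formula it is `(μ - s) (μ - t)` times the second divided difference of `f`. -/
noncomputable def interpolationError (J : Set ℝ) (f : ℝ → ℝ) (s t μ : ℝ) : ℝ :=
  f μ - f s - dividedDiff J f s t * (μ - s)

theorem interpolationError_comm (J : Set ℝ) (f : ℝ → ℝ) (s t μ : ℝ) :
    interpolationError J f s t μ = interpolationError J f t s μ := by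
  rw [interpolationError, interpolationError, dividedDiff_comm J f t s]
  linear_combination dividedDiff_mul_sub J f s t

theorem cfc_interpolationError {ι : Type*} [Fintype ι] [DecidableEq ι] {A : Matrix ι ι ℂ}
    (hA : A.IsHermitian) (J : Set ℝ) (f : ℝ → ℝ) (s t : ℝ) :
    cfc (interpolationError J f s t) A =
      cfc f A - f s • 1 - dividedDiff J f s t • (A - s • 1) := by
  have hA' : IsSelfAdjoint A := hA
  have hc := fun u : ℝ → ℝ => continuousOn_real_spectrum u A
  simp only [← Algebra.algebraMap_eq_smul_one]
  unfold interpolationError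
  rw [cfc_sub _ _ A (hc _) (hc _), cfc_sub _ _ A (hc _) (hc _), cfc_const_mul _ _ A (hc _),
    cfc_sub _ _ A (hc _) (hc _), cfc_const _ A, cfc_const _ A, cfc_id' ℝ A]

theorem posSemidef_cfc_sub_diagonal_sub_hadamard {A : Matrix (Fin n) (Fin n) ℂ}
    (hA : A.IsHermitian) {s : Fin n → ℝ}
    (h : ∀ μ ∈ spectrum ℝ A,
      (Matrix.of fun i j => interpolationError J f (s i) (s j) μ).PosSemidef) :
    (cfc f A - (diagonal fun i => (f (s i) : ℂ)) -
      (loewnerMatrix J f s).hadamard (A - diagonal fun i => (s i : ℂ))).PosSemidef := by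
  convert! posSemidef_of_cfc_apply hA fun μ hμ => posSemidef_map_ofReal (h μ hμ) using 1
  ext i j
  simp only [Matrix.of_apply]
  rw [cfc_interpolationError hA]
  simp [loewnerMatrix, diagonal_apply, one_apply]

theorem posSemidef_convexComb_cfc_sub_diagonal {A B : Matrix (Fin n) (Fin n) ℂ}
    (hA : A.IsHermitian) (hB : B.IsHermitian) {c : ℝ} (hc0 : 0 ≤ c) (hc1 : c ≤ 1) {s : Fin n → ℝ}
    (hs : c • A + (1 - c) • B = diagonal fun i => (s i : ℂ))
    (h : ∀ μ ∈ spectrum ℝ A ∪ spectrum ℝ B,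
      (Matrix.of fun i j => interpolationError J f (s i) (s j) μ).PosSemidef) :
    (c • cfc f A + (1 - c) • cfc f B - diagonal fun i => (f (s i) : ℂ)).PosSemidef := by
  have hremA := posSemidef_cfc_sub_diagonal_sub_hadamard hA fun μ hμ => h μ (.inl hμ)
  have hremB := posSemidef_cfc_sub_diagonal_sub_hadamard hB fun μ hμ => h μ (.inr hμ)
  convert! (hremA.smul hc0).add (hremB.smul (sub_nonneg.2 hc1)) using 1
  have hlin : c • (A - diagonal fun i => (s i : ℂ)) +
      (1 - c) • (B - diagonal fun i => (s i : ℂ)) = 0 := by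
    rw [← hs]
    module
  have hloewner : c • (loewnerMatrix J f s).hadamard (A - diagonal fun i => (s i : ℂ)) +
      (1 - c) • (loewnerMatrix J f s).hadamard (B - diagonal fun i => (s i : ℂ)) = 0 := by
    rw [← hadamard_smul, ← hadamard_smul, ← hadamard_add, hlin, hadamard_zero]
  rw [smul_sub c (cfc f A - _), smul_sub (1 - c) (cfc f B - _), sub_add_sub_comm, hloewner]
  module

theorem isMatrixConvex_of_posSemidef_interpolationError (hJ : J.OrdConnected)
    (h : ∀ s : Fin n → ℝ, (∀ i, s i ∈ J) → ∀ μ ∈ J,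
      (Matrix.of fun i j => interpolationError J f (s i) (s j) μ).PosSemidef) :
    IsMatrixConvex n J f := by
  intro A B hA hB hAJ hBJ c hc0 hc1
  have hC : (c • A + (1 - c) • B).IsHermitian := isSelfAdjoint_convexComb hA hB c
  have hCJ := spectrum_real_convexComb_subset hA hB hJ hAJ hBJ hc0 hc1
  let U := hC.eigenvectorUnitary
  let φ := Unitary.conjStarAlgAut ℝ (Matrix (Fin n) (Fin n) ℂ) (star U)
  have hφ_cont : Continuous φ :=
    φ.toAlgEquiv.toLinearMap.continuous_of_finiteDimensional
  have hφ_herm : ∀ {M}, M.IsHermitian → (φ M).IsHermitian := fun hM => IsSelfAdjoint.map hM φ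
  have hφ_cfc : ∀ {M}, M.IsHermitian → φ (cfc f M) = cfc f (φ M) := fun {M} hM =>
    StarAlgHomClass.map_cfc (S := ℝ) φ f M (continuousOn_real_spectrum f M)
      hφ_cont hM (hφ_herm hM)
  have hφ_diag : φ (c • A + (1 - c) • B) = diagonal fun i => (hC.eigenvalues i : ℂ) :=
    hC.conjStarAlgAut_star_eigenvectorUnitary
  have hφ_pos : ∀ {M}, (φ M).PosSemidef → M.PosSemidef := fun {M} hM => by
    rw [Unitary.conjStarAlgAut_star_apply] at hM
    exact (Unitary.isUnit_coe (U := U)).posSemidef_star_left_conjugate_iff.1 hM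
  have hcfc_diag : cfc f (diagonal fun i => (hC.eigenvalues i : ℂ)) =
      diagonal fun i => (f (hC.eigenvalues i) : ℂ) := cfc_diagonal f hC.eigenvalues
  refine hφ_pos ?_
  rw [map_sub, map_add, map_smul, map_smul, hφ_cfc hA, hφ_cfc hB, hφ_cfc hC, hφ_diag, hcfc_diag]
  refine posSemidef_convexComb_cfc_sub_diagonal (J := J) (hφ_herm hA) (hφ_herm hB) hc0 hc1
    (by rw [← hφ_diag, map_add, map_smul, map_smul]) fun μ hμ => ?_
  rw [AlgEquiv.spectrum_eq, AlgEquiv.spectrum_eq] at hμ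
  refine h _ (fun i => hCJ ?_) μ (union_subset hAJ hBJ hμ)
  rw [hC.spectrum_real_eq_range_eigenvalues]
  exact mem_range_self i

end Interpolation

section SecondDividedDifferences

variable {J : Set ℝ} {f : ℝ → ℝ} {s t μ : ℝ}

theorem dividedDiff_of_ne (h : s ≠ t) : dividedDiff J f s t = slope f s t := by
  rw [dividedDiff_comm, dividedDiff, if_neg h.symm, slope_def_field]

theorem eventuallyEq_slope_dividedDiff (h : μ ≠ s) : slope f s =ᶠ[𝓝 μ] dividedDiff J f s := by
  filter_upwards [isOpen_ne.mem_nhds h] with r hr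
  exact (dividedDiff_of_ne (Ne.symm hr)).symm

theorem dividedDiff_self (hJ : IsOpen J) (hs : s ∈ J) : dividedDiff J f s s = deriv f s := by
  rw [dividedDiff, if_pos rfl, derivWithin_of_isOpen hJ hs]

theorem hasDerivAt_dividedDiff_self (hJ : IsOpen J) (hf : DifferentiableOn ℝ f J) (hs : s ∈ J) :
    HasDerivAt f (dividedDiff J f s s) s := by
  rw [dividedDiff_self hJ hs]
  exact (hf.differentiableAt (hJ.mem_nhds hs)).hasDerivAt

theorem hasDerivAt_slope (hJ : IsOpen J) (hf : DifferentiableOn ℝ f J) (hμ : μ ∈ J) (h : μ ≠ s) :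
    HasDerivAt (slope f s) ((dividedDiff J f μ μ - dividedDiff J f s μ) / (μ - s)) μ := by
  have hμs : μ - s ≠ 0 := sub_ne_zero.2 h
  rw [slope_fun_def_field]
  refine (((hasDerivAt_dividedDiff_self hJ hf hμ).sub_const (f s)).fun_div
    ((hasDerivAt_id' μ).sub_const s) hμs).congr_deriv ?_
  rw [dividedDiff_of_ne h.symm, slope_def_field]
  field_simp

theorem hasDerivAt_dividedDiff (hJ : IsOpen J) (hf : DifferentiableOn ℝ f J) (hμ : μ ∈ J)
    (h : μ ≠ s) : HasDerivAt (dividedDiff J f s)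
      ((dividedDiff J f μ μ - dividedDiff J f s μ) / (μ - s)) μ :=
  (hasDerivAt_slope hJ hf hμ h).congr_of_eventuallyEq (eventuallyEq_slope_dividedDiff h).symm

theorem continuousAt_dividedDiff (hJ : IsOpen J) (hf : DifferentiableOn ℝ f J) (hs : s ∈ J)
    (hμ : μ ∈ J) : ContinuousAt (dividedDiff J f s) μ := by
  rw [funext (dividedDiff_eq_dslope hJ hs)]
  exact ((continuousOn_dslope (hJ.mem_nhds hs)).2 ⟨hf.continuousOn,
    hf.differentiableAt (hJ.mem_nhds hs)⟩).continuousAt (hJ.mem_nhds hμ)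

theorem monotoneOn_dividedDiff (hJ : IsOpen J) (hf : DifferentiableOn ℝ f J) (hst : Icc s t ⊆ J)
    (h : ∀ r ∈ Ioo s t, dividedDiff J f s r ≤ dividedDiff J f r r) :
    MonotoneOn (dividedDiff J f s) (Icc s t) := by
  refine monotoneOn_of_hasDerivWithinAt_nonneg
    (f' := fun r => (dividedDiff J f r r - dividedDiff J f s r) / (r - s)) (convex_Icc s t)
    (fun r hr => ?_) (fun r hr => ?_) fun r hr => ?_
  · exact (continuousAt_dividedDiff hJ hf (hst ⟨le_rfl, hr.1.trans hr.2⟩)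
      (hst hr)).continuousWithinAt
  · rw [interior_Icc] at hr ⊢
    exact (hasDerivAt_dividedDiff hJ hf (hst (Ioo_subset_Icc_self hr)) hr.1.ne').hasDerivWithinAt
  · rw [interior_Icc] at hr
    exact div_nonneg (sub_nonneg.2 (h r hr)) (sub_nonneg.2 hr.1.le)

/-- The second divided difference `[s, t, μ]_f`, encoded as the difference quotient of
`[s, ·]_f` between `t` and `μ`. At `μ = t` it takes the junk value `0`. -/
noncomputable def secondDividedDiff (J : Set ℝ) (f : ℝ → ℝ) (s t μ : ℝ) : ℝ :=
  (dividedDiff J f s μ - dividedDiff J f s t) / (μ - t)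

theorem secondDividedDiff_comm (hs : μ ≠ s) (ht : μ ≠ t) :
    secondDividedDiff J f s t μ = secondDividedDiff J f t s μ := by
  have hs' := sub_ne_zero.2 hs
  have ht' := sub_ne_zero.2 ht
  rcases eq_or_ne s t with rfl | hst
  · rfl
  have hst' := sub_ne_zero.2 hst
  rw [secondDividedDiff, secondDividedDiff, dividedDiff_comm J f t s,
    div_eq_div_iff ht' hs', dividedDiff_of_ne hs.symm, dividedDiff_of_ne ht.symm,
    dividedDiff_comm, dividedDiff_of_ne hst.symm]
  simp only [slope_def_field]
  field_simp
  ring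

theorem dividedDiff_slope (hJ : IsOpen J) (hf : DifferentiableOn ℝ f J) (hs : s ∈ J) (hsμ : s ≠ μ)
    (htμ : t ≠ μ) : dividedDiff J (slope f μ) s t = secondDividedDiff J f s t μ := by
  rcases eq_or_ne s t with rfl | hst
  · rw [dividedDiff_self hJ hs, (hasDerivAt_slope hJ hf hs hsμ).deriv, secondDividedDiff,
      dividedDiff_comm J f μ, ← neg_sub s μ, ← neg_sub (dividedDiff J f s s), neg_div_neg_eq]
  · rw [secondDividedDiff, dividedDiff_of_ne hst, dividedDiff_of_ne hsμ, dividedDiff_of_ne hst]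
    have hμs' := sub_ne_zero.2 hsμ.symm
    have hsμ' := sub_ne_zero.2 hsμ
    have hμt' := sub_ne_zero.2 htμ.symm
    have htμ' := sub_ne_zero.2 htμ
    have hts' := sub_ne_zero.2 hst.symm
    simp only [slope_def_field]
    field_simp
    ring

theorem interpolationError_eq_mul_secondDividedDiff (J : Set ℝ) (f : ℝ → ℝ) (s t μ : ℝ) :
    interpolationError J f s t μ = (μ - s) * (μ - t) * secondDividedDiff J f s t μ := by
  rcases eq_or_ne μ t with rfl | h
  · rw [interpolationError, sub_self, mul_zero, zero_mul, dividedDiff_comm, dividedDiff_mul_sub,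
      sub_self]
  · rw [secondDividedDiff, mul_assoc, mul_div_cancel₀ _ (sub_ne_zero.2 h), interpolationError,
      ← dividedDiff_mul_sub J f μ s, dividedDiff_comm J f μ s]
    ring

theorem hasDerivAt_secondDividedDiff (hJ : IsOpen J) (hf : DifferentiableOn ℝ f J) (hμ : μ ∈ J)
    (hs : μ ≠ s) (ht : μ ≠ t) :
    HasDerivAt (secondDividedDiff J f s t)
      ((dividedDiff J f s t - dividedDiff J f s μ - dividedDiff J f μ t + dividedDiff J f μ μ) /
        ((μ - s) * (μ - t))) μ := by
  have hs' := sub_ne_zero.2 hs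
  have ht' := sub_ne_zero.2 ht
  have hcomm := secondDividedDiff_comm (J := J) (f := f) hs ht
  rw [secondDividedDiff, secondDividedDiff, dividedDiff_comm J f t s,
    div_eq_div_iff ht' hs'] at hcomm
  refine (((hasDerivAt_dividedDiff hJ hf hμ hs).sub_const (dividedDiff J f s t)).fun_div
    ((hasDerivAt_id' μ).sub_const t) ht').congr_deriv ?_
  rw [dividedDiff_comm J f μ t, div_eq_div_iff (pow_ne_zero 2 ht') (mul_ne_zero hs' ht')]
  field_simp
  linear_combination -hcomm

end SecondDividedDifferences

section ConditionalPositivity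

variable {J : Set ℝ} {f : ℝ → ℝ}

theorem classQ_mono {n : ℕ} {I : Set ℝ} (hJ : IsOpen J) (hJI : J ⊆ I) :
    classQ n I ⊆ classQ n J := by
  refine fun f hf => ⟨hf.1.mono hJI, fun l hl => ?_⟩
  convert hf.2 l fun i => hJI (hl i) using 1
  ext i j
  simp only [loewnerMatrix, Matrix.of_apply, dividedDiff, derivWithin_of_isOpen hJ (hl i),
    derivWithin_of_mem_nhds (mem_of_superset (hJ.mem_nhds (hl i)) hJI)]

theorem re_dotProduct_loewnerMatrix_mulVec {n : ℕ} (J : Set ℝ) (f : ℝ → ℝ) (l x : Fin n → ℝ) :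
    (star (fun i => (x i : ℂ)) ⬝ᵥ loewnerMatrix J f l *ᵥ fun i => (x i : ℂ)).re =
      ∑ i, ∑ j, x i * x j * dividedDiff J f (l i) (l j) := by
  simp only [dotProduct, mulVec, loewnerMatrix, Matrix.of_apply, Pi.star_apply, RCLike.star_def,
    Complex.conj_ofReal, Complex.re_sum, Finset.mul_sum, ← Complex.ofReal_mul, Complex.ofReal_re]
  exact Finset.sum_congr rfl fun i _ => Finset.sum_congr rfl fun j _ => by ring

theorem sum_mul_dividedDiff_nonneg_of_mem_classQ {n : ℕ} (hf : f ∈ classQ n J) {l : Fin n → ℝ}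
    (hl : ∀ i, l i ∈ J) {x : Fin n → ℝ} (hx : ∑ i, x i = 0) :
    0 ≤ ∑ i, ∑ j, x i * x j * dividedDiff J f (l i) (l j) := by
  rw [← re_dotProduct_loewnerMatrix_mulVec]
  exact (hf.2 l hl).2 _ (mod_cast hx)

theorem sum_mul_mixedDifference_dividedDiff_nonneg {m : ℕ} (hf : f ∈ classQ (m + 1) J)
    {s : Fin m → ℝ} (hs : ∀ i, s i ∈ J) {μ : ℝ} (hμ : μ ∈ J) (y : Fin m → ℝ) :
    0 ≤ ∑ i, ∑ j, y i * y j * (dividedDiff J f (s i) (s j) - dividedDiff J f (s i) μ -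
      dividedDiff J f μ (s j) + dividedDiff J f μ μ) := by
  have h := sum_mul_dividedDiff_nonneg_of_mem_classQ hf (l := Fin.cons μ s)
    (x := Fin.cons (-∑ i, y i) y) (Fin.forall_fin_succ.2 ⟨hμ, hs⟩)
    (by simp only [Fin.sum_univ_succ, Fin.cons_zero, Fin.cons_succ, neg_add_cancel])
  refine h.trans_eq ?_
  simp only [Fin.sum_univ_succ, Fin.cons_zero, Fin.cons_succ, Finset.sum_add_distrib, mul_add,
    mul_sub, Finset.sum_sub_distrib, neg_mul, mul_neg, Finset.sum_neg_distrib,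
    Finset.sum_mul, Finset.mul_sum]
  have hswap (a : Fin m → ℝ) : ∑ i, ∑ j, y j * y i * a i = ∑ i, ∑ j, y i * y j * a j :=
    Finset.sum_comm
  rw [hswap fun i => dividedDiff J f μ (s i), hswap fun _ => dividedDiff J f μ μ]
  ring

theorem two_mul_dividedDiff_le {n : ℕ} (hn : 2 ≤ n) (hf : f ∈ classQ n J) {s t : ℝ} (hs : s ∈ J)
    (ht : t ∈ J) : 2 * dividedDiff J f s t ≤ dividedDiff J f s s + dividedDiff J f t t := by
  obtain ⟨m, rfl⟩ : ∃ m, n = m + 1 + 1 := ⟨n - 2, by omega⟩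
  have h := sum_mul_mixedDifference_dividedDiff_nonneg hf (fun _ => hs) ht (Pi.single 0 1)
  simp only [Pi.single_apply, ite_mul, one_mul, zero_mul, Finset.sum_ite_irrel,
    Finset.sum_ite_eq', Finset.sum_const_zero, Finset.mem_univ, if_true,
    dividedDiff_comm J f t s] at h
  linarith

theorem dividedDiff_self_le_dividedDiff_add_sub {n : ℕ} (hn : 2 ≤ n) (hJ : IsOpen J)
    (hf : f ∈ classQ n J) {c h : ℝ} (hh : 0 < h) (hc : Icc (c - h) (c + h) ⊆ J) :
    dividedDiff J f c c ≤ dividedDiff J f (c + h) (c - h) := by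
  have hd : DifferentiableOn ℝ f J := hf.1.differentiableOn one_ne_zero
  -- `[c + h, c - h]_f` is half the slope of `g` between `0` and `h`, and by
  -- `2 [s, t]_f ≤ [s, s]_f + [t, t]_f` this slope is at most `g'(h)`.
  let K : Set ℝ := (c + ·) ⁻¹' J ∩ (c - ·) ⁻¹' J
  let g : ℝ → ℝ := fun r => f (c + r) - f (c - r)
  have hK : IsOpen K := (hJ.preimage (by fun_prop)).inter (hJ.preimage (by fun_prop))
  have hsub : Icc 0 h ⊆ K := fun r hr =>
    ⟨hc ⟨by linarith [hr.1], by linarith [hr.2]⟩, hc ⟨by linarith [hr.2], by linarith [hr.1]⟩⟩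
  have hg : ∀ r ∈ K, HasDerivAt g
      (dividedDiff J f (c + r) (c + r) + dividedDiff J f (c - r) (c - r)) r := fun r hr => by
    rw [← sub_neg_eq_add]
    exact ((hasDerivAt_dividedDiff_self hJ hd hr.1).comp_const_add c r).sub
      ((hasDerivAt_dividedDiff_self hJ hd hr.2).comp_const_sub c r)
  have hgK : DifferentiableOn ℝ g K := fun r hr => (hg r hr).differentiableAt.differentiableWithinAt
  have hg_self : ∀ r ∈ K, dividedDiff K g r r =
      dividedDiff J f (c + r) (c + r) + dividedDiff J f (c - r) (c - r) := fun r hr => by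
    rw [dividedDiff_self hK hr, (hg r hr).deriv]
  have hg_zero : ∀ r ∈ K, dividedDiff K g 0 r = 2 * dividedDiff J f (c + r) (c - r) := by
    intro r hr
    rcases eq_or_ne r 0 with rfl | hr0
    · rw [hg_self 0 hr, add_zero, sub_zero, two_mul]
    · have hne : c + r ≠ c - r := fun h => hr0 (by linarith)
      rw [dividedDiff_of_ne hr0.symm, dividedDiff_comm, dividedDiff_of_ne hne.symm,
        slope_def_field, slope_def_field, show c + r - (c - r) = 2 * r by ring]
      simp only [g, add_zero, sub_zero, sub_self]
      field_simp
  have hmono : MonotoneOn (dividedDiff K g 0) (Icc 0 h) :=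
    monotoneOn_dividedDiff hK hgK hsub fun r hr => by
      have hrK := hsub (Ioo_subset_Icc_self hr)
      rw [hg_self r hrK, hg_zero r hrK]
      exact two_mul_dividedDiff_le hn hf hrK.1 hrK.2
  have hle := hmono (left_mem_Icc.2 hh.le) (right_mem_Icc.2 hh.le) hh.le
  rw [hg_zero 0 (hsub (left_mem_Icc.2 hh.le)), hg_zero h (hsub (right_mem_Icc.2 hh.le)),
    add_zero, sub_zero] at hle
  exact le_of_mul_le_mul_left hle two_pos

end ConditionalPositivity

section Monotonicity

theorem tendsto_const_add_nhdsGT_zero (c : ℝ) : Tendsto (fun h => c + h) (𝓝[>] 0) (𝓝 c) :=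
  ((continuous_const_add c).tendsto' 0 c (add_zero c)).mono_left nhdsWithin_le_nhds

theorem tendsto_const_sub_nhdsGT_zero (c : ℝ) : Tendsto (fun h => c - h) (𝓝[>] 0) (𝓝 c) :=
  ((continuous_sub_left c).tendsto' 0 c (sub_zero c)).mono_left nhdsWithin_le_nhds

theorem le_of_forall_Icc_disjoint_of_forall_crossing {F : ℝ → ℝ} {T : Finset ℝ} {a b : ℝ}
    (hab : a ≤ b) (ha : a ∉ T) (hb : b ∉ T)
    (hmono : ∀ u v, a ≤ u → u ≤ v → v ≤ b → (∀ c ∈ T, c ∉ Icc u v) → F u ≤ F v)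
    (hcross : ∀ c ∈ T, c ∈ Ioo a b → ∀ ε > 0, ∀ᶠ h in 𝓝[>] 0, F (c - h) ≤ F (c + h) + ε) :
    F a ≤ F b := by
  induction T using Finset.induction generalizing a b with
  | empty => exact hmono a b le_rfl hab le_rfl (by simp)
  | insert c T hcT ih =>
    simp only [Finset.mem_insert, not_or] at ha hb
    have ih_Icc : ∀ u v, a ≤ u → u ≤ v → v ≤ b → u ∉ T → v ∉ T → c ∉ Icc u v → F u ≤ F v :=
      fun u v hau huv hvb hu hv hc => ih huv hu hv
        (fun p q hp hpq hq hT => hmono p q (hau.trans hp) hpq (hq.trans hvb)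
          (Finset.forall_mem_insert _ _ _ |>.2
            ⟨fun hcpq => hc ⟨hp.trans hcpq.1, hcpq.2.trans hq⟩, hT⟩))
        fun d hd hduv => hcross d (Finset.mem_insert_of_mem hd)
          ⟨hau.trans_lt hduv.1, hduv.2.trans_le hvb⟩
    by_cases hc : c ∈ Icc a b
    swap
    · exact ih_Icc a b le_rfl hab le_rfl ha.2 hb.2 hc
    have hac : a < c := lt_of_le_of_ne hc.1 ha.1
    have hcb : c < b := lt_of_le_of_ne hc.2 (Ne.symm hb.1)
    refine le_of_forall_pos_le_add fun ε hε => ?_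
    have hT : (T : Set ℝ)ᶜ ∈ 𝓝 c := T.finite_toSet.isClosed.compl_mem_nhds (by simpa using hcT)
    obtain ⟨h, hcr, hl, hr, hlT, hrT, hpos⟩ :=
      ((hcross c (Finset.mem_insert_self c T) ⟨hac, hcb⟩ ε hε).and
      (((tendsto_const_sub_nhdsGT_zero c).eventually_const_le hac).and
      (((tendsto_const_add_nhdsGT_zero c).eventually_le_const hcb).and
      (((tendsto_const_sub_nhdsGT_zero c).eventually hT).and
      (((tendsto_const_add_nhdsGT_zero c).eventually hT).and self_mem_nhdsWithin))))).exists
    have hsub : c - h < c := sub_lt_self c hpos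
    have hadd : c < c + h := lt_add_of_pos_right c hpos
    calc F a ≤ F (c - h) :=
          ih_Icc a (c - h) le_rfl hl (hsub.trans hcb).le ha.2 hlT fun hc => hc.2.not_gt hsub
      _ ≤ F (c + h) + ε := hcr
      _ ≤ F b + ε := add_le_add_left
          (ih_Icc (c + h) b (hac.trans hadd).le hr le_rfl hrT hb.2 fun hc => hc.1.not_gt hadd) ε

variable {J : Set ℝ} {f : ℝ → ℝ} {m : ℕ} {s : Fin m → ℝ}

/-- The quadratic form at `x` of the matrix `([s i, s j, μ]_f)` of second divided differences. -/
noncomputable def secondDividedDiffForm (J : Set ℝ) (f : ℝ → ℝ) (s x : Fin m → ℝ) (μ : ℝ) : ℝ :=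
  ∑ i, ∑ j, x i * x j * secondDividedDiff J f (s i) (s j) μ

theorem hasDerivAt_secondDividedDiffForm (hJ : IsOpen J) (hf : DifferentiableOn ℝ f J) {μ : ℝ}
    (hμ : μ ∈ J) (hs : ∀ i, μ ≠ s i) (x : Fin m → ℝ) :
    HasDerivAt (secondDividedDiffForm J f s x)
      (∑ i, ∑ j, x i / (μ - s i) * (x j / (μ - s j)) * (dividedDiff J f (s i) (s j) -
        dividedDiff J f (s i) μ - dividedDiff J f μ (s j) + dividedDiff J f μ μ)) μ := by
  unfold secondDividedDiffForm
  refine HasDerivAt.fun_sum fun i _ => HasDerivAt.fun_sum fun j _ =>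
    ((hasDerivAt_secondDividedDiff hJ hf hμ (hs i) (hs j)).const_mul (x i * x j)).congr_deriv ?_
  rw [mul_div_assoc', div_mul_div_comm, div_mul_eq_mul_div]

theorem monotoneOn_secondDividedDiffForm (hJ : IsOpen J) (hf : f ∈ classQ (m + 1) J)
    (hs : ∀ i, s i ∈ J) {u v : ℝ} (huv : Icc u v ⊆ J) (hsuv : ∀ i, s i ∉ Icc u v)
    (x : Fin m → ℝ) : MonotoneOn (secondDividedDiffForm J f s x) (Icc u v) := by
  have hderiv := fun μ (hμ : μ ∈ Icc u v) => hasDerivAt_secondDividedDiffForm (s := s) hJ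
    (hf.1.differentiableOn one_ne_zero) (huv hμ) (fun i h => hsuv i (h ▸ hμ)) x
  refine monotoneOn_of_hasDerivWithinAt_nonneg (convex_Icc u v)
    (fun μ hμ => (hderiv μ hμ).continuousAt.continuousWithinAt)
    (fun μ hμ => (hderiv μ (interior_subset hμ)).hasDerivWithinAt) fun μ hμ =>
      sum_mul_mixedDifference_dividedDiff_nonneg hf hs (huv (interior_subset hμ)) _

theorem continuousAt_secondDividedDiff (hJ : IsOpen J) (hf : DifferentiableOn ℝ f J) {s t c : ℝ}
    (hs : s ∈ J) (hc : c ∈ J) (hct : c ≠ t) : ContinuousAt (secondDividedDiff J f s t) c :=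
  ((continuousAt_dividedDiff hJ hf hs hc).sub continuousAt_const).div
    (continuousAt_id.sub continuousAt_const) (sub_ne_zero.2 hct)

theorem tendsto_secondDividedDiff_sub (hJ : IsOpen J) (hf : DifferentiableOn ℝ f J) {s t c : ℝ}
    (hs : s ∈ J) (ht : t ∈ J) (hc : c ∈ J) (h : ¬(s = c ∧ t = c)) :
    Tendsto (fun h => secondDividedDiff J f s t (c + h) - secondDividedDiff J f s t (c - h))
      (𝓝[>] 0) (𝓝 0) := by
  have of_ne : ∀ {s t : ℝ}, s ∈ J → c ≠ t → Tendsto (fun h => secondDividedDiff J f s t (c + h) -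
      secondDividedDiff J f s t (c - h)) (𝓝[>] 0) (𝓝 0) := fun hs hct => by
    have hcont := (continuousAt_secondDividedDiff hJ hf hs hc hct).tendsto
    exact sub_self (secondDividedDiff J f _ _ c) ▸
      (hcont.comp (tendsto_const_add_nhdsGT_zero c)).sub
        (hcont.comp (tendsto_const_sub_nhdsGT_zero c))
  by_cases hct : c = t
  · subst hct
    have hcs : c ≠ s := fun hcs => h ⟨hcs.symm, rfl⟩
    refine (of_ne ht hcs).congr' ?_
    filter_upwards [self_mem_nhdsWithin, (tendsto_const_add_nhdsGT_zero c).eventually_ne hcs,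
      (tendsto_const_sub_nhdsGT_zero c).eventually_ne hcs] with h hpos hadd_ne hsub_ne
    have hpos : 0 < h := hpos
    rw [secondDividedDiff_comm (by linarith) hadd_ne,
      secondDividedDiff_comm (by linarith) hsub_ne]
  · exact of_ne hs hct

theorem secondDividedDiff_self_sub {c h : ℝ} (hh : h ≠ 0) :
    secondDividedDiff J f c c (c + h) - secondDividedDiff J f c c (c - h) =
      2 * (dividedDiff J f (c + h) (c - h) - dividedDiff J f c c) / h := by
  have hright := dividedDiff_mul_sub J f c (c + h)
  have hleft := dividedDiff_mul_sub J f c (c - h)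
  have hsymm := dividedDiff_mul_sub J f (c + h) (c - h)
  have hadd : dividedDiff J f c (c + h) + dividedDiff J f c (c - h) =
      2 * dividedDiff J f (c + h) (c - h) := by
    refine mul_right_cancel₀ hh ?_
    linear_combination -hright + hleft - hsymm
  rw [secondDividedDiff, secondDividedDiff, add_sub_cancel_left, sub_sub_cancel_left]
  field_simp
  linear_combination hadd

/-- Only the pairs with both nodes at `c` are singular as `h → 0`; they carry the square. -/
theorem secondDividedDiffForm_add_sub_sub (J : Set ℝ) (f : ℝ → ℝ) (s x : Fin m → ℝ) (c : ℝ) {h : ℝ}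
    (hh : h ≠ 0) :
    secondDividedDiffForm J f s x (c + h) - secondDividedDiffForm J f s x (c - h) =
      ∑ i, ∑ j, x i * x j * (if s i = c ∧ s j = c then 0 else
        secondDividedDiff J f (s i) (s j) (c + h) - secondDividedDiff J f (s i) (s j) (c - h)) +
      (∑ i, if s i = c then x i else 0) ^ 2 *
        (2 * (dividedDiff J f (c + h) (c - h) - dividedDiff J f c c) / h) := by
  rw [sq, Finset.sum_mul_sum]
  simp only [secondDividedDiffForm, ← Finset.sum_sub_distrib, Finset.sum_mul,
    ← Finset.sum_add_distrib]
  refine Finset.sum_congr rfl fun i _ => Finset.sum_congr rfl fun j _ => ?_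
  by_cases hi : s i = c
  · by_cases hj : s j = c
    · simp only [hi, hj, and_self, if_true, ← secondDividedDiff_self_sub hh]
      ring
    · simp only [hj, and_false, if_false, mul_zero, zero_mul, add_zero, mul_sub]
  · simp only [hi, false_and, if_false, zero_mul, add_zero, mul_sub]

theorem eventually_secondDividedDiffForm_sub_le_add (hJ : IsOpen J) (hf : f ∈ classQ (m + 1) J)
    (hs : ∀ i, s i ∈ J) (x : Fin m → ℝ) (k : Fin m) {ε : ℝ} (hε : 0 < ε) :
    ∀ᶠ h in 𝓝[>] 0, secondDividedDiffForm J f s x (s k - h) ≤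
      secondDividedDiffForm J f s x (s k + h) + ε := by
  have hregular : Tendsto (fun h => ∑ i, ∑ j, x i * x j * (if s i = s k ∧ s j = s k then 0 else
      secondDividedDiff J f (s i) (s j) (s k + h) - secondDividedDiff J f (s i) (s j) (s k - h)))
      (𝓝[>] 0) (𝓝 (∑ i, ∑ j, x i * x j * 0)) := by
    refine tendsto_finsetSum _ fun i _ => tendsto_finsetSum _ fun j _ => Tendsto.const_mul _ ?_
    split_ifs with hij
    · exact tendsto_const_nhds
    · exact tendsto_secondDividedDiff_sub hJ (hf.1.differentiableOn one_ne_zero) (hs i) (hs j)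
        (hs k) hij
  simp only [mul_zero, Finset.sum_const_zero] at hregular
  have hIcc : ∀ᶠ h in 𝓝[>] (0 : ℝ), Icc (s k - h) (s k + h) ⊆ J := by
    obtain ⟨δ, hδ, hδJ⟩ := Metric.nhds_basis_closedBall.mem_iff.1 (hJ.mem_nhds (hs k))
    filter_upwards [Ioc_mem_nhdsGT hδ] with h hh
    rw [← Real.closedBall_eq_Icc]
    exact (Metric.closedBall_subset_closedBall hh.2).trans hδJ
  filter_upwards [hregular.eventually_const_le (neg_lt_zero.2 hε), hIcc, self_mem_nhdsWithin]
    with h hregular_ge hJh hpos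
  have hpos : 0 < h := hpos
  have hmid := dividedDiff_self_le_dividedDiff_add_sub (by have := k.pos; omega) hJ hf hpos hJh
  have hsingular : 0 ≤ (∑ i, if s i = s k then x i else 0) ^ 2 *
      (2 * (dividedDiff J f (s k + h) (s k - h) - dividedDiff J f (s k) (s k)) / h) :=
    mul_nonneg (sq_nonneg _) (div_nonneg (mul_nonneg two_pos.le (sub_nonneg.2 hmid)) hpos.le)
  linarith [secondDividedDiffForm_add_sub_sub J f s x (s k) hpos.ne']

theorem secondDividedDiffForm_le (hJ : IsOpen J) (hf : f ∈ classQ (m + 1) J)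
    (hs : ∀ i, s i ∈ J) {u v : ℝ} (huv : u ≤ v) (hJuv : Icc u v ⊆ J) (hsu : ∀ i, s i ≠ u)
    (hsv : ∀ i, s i ≠ v) (x : Fin m → ℝ) :
    secondDividedDiffForm J f s x u ≤ secondDividedDiffForm J f s x v := by
  refine le_of_forall_Icc_disjoint_of_forall_crossing (T := Finset.univ.image s) huv
    (by simpa using hsu) (by simpa using hsv) (fun p q hp hpq hq hT => ?_) ?_
  · exact monotoneOn_secondDividedDiffForm hJ hf hs ((Icc_subset_Icc hp hq).trans hJuv)
      (fun i => hT _ (Finset.mem_image_of_mem s (Finset.mem_univ i))) x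
      (left_mem_Icc.2 hpq) (right_mem_Icc.2 hpq) hpq
  · simp only [Finset.forall_mem_image]
    exact fun i _ _ ε hε => eventually_secondDividedDiffForm_sub_le_add hJ hf hs x i hε

theorem continuousWithinAt_secondDividedDiff {ν s t : ℝ}
    (hf : ContinuousWithinAt f (Ioi ν) ν) (hs : ν ≠ s) (ht : ν ≠ t) :
    ContinuousWithinAt (secondDividedDiff J f s t) (Ioi ν) ν := by
  have hslope : ContinuousWithinAt (slope f s) (Ioi ν) ν := by
    rw [slope_fun_def_field]
    exact (hf.sub continuousWithinAt_const).div
      (continuousWithinAt_id.sub continuousWithinAt_const) (sub_ne_zero.2 hs)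
  have hdiv : ContinuousWithinAt (dividedDiff J f s) (Ioi ν) ν :=
    hslope.congr_of_eventuallyEq
      ((eventuallyEq_slope_dividedDiff hs).symm.filter_mono nhdsWithin_le_nhds)
      (dividedDiff_of_ne hs.symm)
  exact (hdiv.sub continuousWithinAt_const).div
    (continuousWithinAt_id.sub continuousWithinAt_const) (sub_ne_zero.2 ht)

theorem secondDividedDiffForm_le_of_Ioc_subset (hJ : IsOpen J) (hf : f ∈ classQ (m + 1) J)
    (hs : ∀ i, s i ∈ J) {ν μ : ℝ} (hνμ : ν < μ) (hJνμ : Ioc ν μ ⊆ J)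
    (hfν : ContinuousWithinAt f (Ioi ν) ν) (hsν : ∀ i, s i ≠ ν) (hsμ : ∀ i, s i ≠ μ)
    (x : Fin m → ℝ) :
    secondDividedDiffForm J f s x ν ≤ secondDividedDiffForm J f s x μ := by
  have hlim : Tendsto (secondDividedDiffForm J f s x) (𝓝[>] ν)
      (𝓝 (secondDividedDiffForm J f s x ν)) :=
    tendsto_finsetSum _ fun i _ => tendsto_finsetSum _ fun j _ =>
      (continuousWithinAt_secondDividedDiff hfν (hsν i).symm (hsν j).symm).tendsto.const_mul _
  have hs_ne : ∀ᶠ u in 𝓝[>] ν, ∀ i, s i ≠ u :=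
    eventually_all.2 fun i =>
      nhdsWithin_le_nhds ((eventually_ne_nhds (hsν i).symm).mono fun _ => Ne.symm)
  refine le_of_tendsto hlim ?_
  filter_upwards [Ioo_mem_nhdsGT hνμ, hs_ne] with u hu hsu
  exact secondDividedDiffForm_le hJ hf hs hu.2.le
    (fun r hr => hJνμ ⟨hu.1.trans_le hr.1, hr.2⟩) hsu hsμ x

end Monotonicity

section MonotoneSlope

variable {J : Set ℝ} {f : ℝ → ℝ} {m : ℕ} {s : Fin m → ℝ} {ν μ : ℝ}

theorem IsMatrixMonotone.secondDividedDiffForm_nonneg (hJ : IsOpen J) (hf : DifferentiableOn ℝ f J)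
    (hν : ν ∉ J) (hmono : IsMatrixMonotone m J (slope f ν)) (hs : ∀ i, s i ∈ J) (x : Fin m → ℝ) :
    0 ≤ secondDividedDiffForm J f s x ν := by
  have hne : ∀ r ∈ J, r ≠ ν := fun r hr h => hν (h ▸ hr)
  have hslope : DifferentiableOn ℝ (slope f ν) J := fun r hr =>
    (hasDerivAt_slope hJ hf hr (hne r hr)).differentiableAt.differentiableWithinAt
  have hpos := (hmono.posSemidef_loewnerMatrix hJ hslope hs).re_dotProduct_nonneg
    fun i => (x i : ℂ)
  rw [RCLike.re_to_complex, re_dotProduct_loewnerMatrix_mulVec] at hpos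
  refine hpos.trans_eq (Finset.sum_congr rfl fun i _ => Finset.sum_congr rfl fun j _ => ?_)
  rw [dividedDiff_slope hJ hf (hs i) (hne _ (hs i)) (hne _ (hs j))]

theorem posSemidef_interpolationError (hJ : IsOpen J) (hf : f ∈ classQ (m + 1) J)
    (hν : ν ∉ J) (hfν : ContinuousWithinAt f (Ioi ν) ν)
    (hmono : IsMatrixMonotone m J (slope f ν)) (hνμ : ν < μ) (hJνμ : Ioc ν μ ⊆ J)
    (hs : ∀ i, s i ∈ J) :
    (Matrix.of fun i j => interpolationError J f (s i) (s j) μ).PosSemidef := by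
  have hherm : (Matrix.of fun i j => interpolationError J f (s i) (s j) μ).IsHermitian :=
    Matrix.ext fun i j => interpolationError_comm J f (s j) (s i) μ
  refine .of_dotProduct_mulVec_nonneg hherm fun x => ?_
  obtain ⟨r, hνr, hrμ⟩ := exists_between hνμ
  -- Nodes equal to `μ` may be moved: the factor `μ - s i` kills their contribution.
  let s' : Fin m → ℝ := fun i => if s i = μ then r else s i
  have hs' : ∀ i, s' i ∈ J := fun i => by
    simp only [s']
    split_ifs
    exacts [hJνμ ⟨hνr, hrμ.le⟩, hs i]
  have hs'μ : ∀ i, s' i ≠ μ := fun i => by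
    simp only [s']
    split_ifs with h
    exacts [hrμ.ne, h]
  have hform : star x ⬝ᵥ (Matrix.of fun i j => interpolationError J f (s i) (s j) μ) *ᵥ x =
      secondDividedDiffForm J f s' (fun i => x i * (μ - s i)) μ := by
    simp only [dotProduct, mulVec, Finset.mul_sum, Matrix.of_apply, Pi.star_apply, star_trivial,
      secondDividedDiffForm, interpolationError_eq_mul_secondDividedDiff, s']
    refine Finset.sum_congr rfl fun i _ => Finset.sum_congr rfl fun j _ => ?_
    by_cases hi : s i = μ
    · simp only [hi, sub_self, mul_zero, zero_mul]
    by_cases hj : s j = μ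
    · simp only [hj, sub_self, mul_zero, zero_mul]
    rw [if_neg hi, if_neg hj]
    ring
  rw [hform]
  exact (hmono.secondDividedDiffForm_nonneg hJ (hf.1.differentiableOn one_ne_zero) hν hs' _).trans
    (secondDividedDiffForm_le_of_Ioc_subset hJ hf hs' hνμ hJνμ hfν
      (fun i h => hν (h ▸ hs' i)) hs'μ _)

end MonotoneSlope

section HalfOpenInterval

variable {α : EReal}

theorem isOpen_openInterval (α : EReal) : IsOpen (openInterval α) :=
  isOpen_Ioi.inter (isOpen_Iio.preimage continuous_coe_real_ereal)

theorem Ioc_zero_subset_openInterval {t : ℝ} (ht : t ∈ openInterval α) :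
    Ioc 0 t ⊆ openInterval α :=
  fun _ hs => ⟨hs.1, (EReal.coe_le_coe_iff.2 hs.2).trans_lt ht.2⟩

theorem ordConnected_openInterval (α : EReal) : (openInterval α).OrdConnected :=
  ⟨fun _ ha _ hb _ ht => Ioc_zero_subset_openInterval hb ⟨ha.1.trans_le ht.1, ht.2⟩⟩

theorem openInterval_subset_leftClosedInterval (α : EReal) :
    openInterval α ⊆ leftClosedInterval α :=
  fun _ ht => ⟨ht.1.le, ht.2⟩

theorem ordConnected_leftClosedInterval (α : EReal) : (leftClosedInterval α).OrdConnected :=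
  ⟨fun _ ha _ hb _ ht => ⟨ha.1.trans ht.1, (EReal.coe_le_coe_iff.2 ht.2).trans_lt hb.2⟩⟩

theorem Icc_zero_subset_leftClosedInterval {t : ℝ} (ht : t ∈ openInterval α) :
    Icc 0 t ⊆ leftClosedInterval α :=
  fun _ hs => ⟨hs.1, (EReal.coe_le_coe_iff.2 hs.2).trans_lt ht.2⟩

theorem zero_mem_leftClosedInterval (hα : 0 < α) : 0 ∈ leftClosedInterval α :=
  ⟨le_rfl, hα⟩

theorem exists_mem_openInterval_gt {b : ℝ} (hb : b ∈ leftClosedInterval α) :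
    ∃ β ∈ openInterval α, b < β := by
  obtain ⟨β, hbβ, hβα⟩ := EReal.lt_iff_exists_real_btwn.1 hb.2
  have hbβ := EReal.coe_lt_coe_iff.1 hbβ
  exact ⟨β, ⟨hb.1.trans_lt hbβ, hβα⟩, hbβ⟩

variable {𝓐 : Type*} [CStarAlgebra 𝓐] {a : 𝓐} {f : ℝ → ℝ}

theorem exists_eventually_spectrum_real_add_smul_one_subset_Ioc (hα : 0 < α)
    (ha : spectrum ℝ a ⊆ leftClosedInterval α) :
    ∃ β ∈ openInterval α, spectrum ℝ a ⊆ Icc 0 β ∧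
      ∀ᶠ ε : ℝ in 𝓝[>] 0, spectrum ℝ (a + ε • 1) ⊆ Ioc 0 β := by
  obtain ⟨b, hb, hmax⟩ :=
    ((spectrum.isCompact (𝕜 := ℝ) a).insert 0).exists_isGreatest (insert_nonempty _ _)
  obtain ⟨β, hβ, hbβ⟩ :=
    exists_mem_openInterval_gt (insert_subset (zero_mem_leftClosedInterval hα) ha hb)
  refine ⟨β, hβ, fun t ht => ⟨(ha ht).1, (hmax (.inr ht)).trans hbβ.le⟩, ?_⟩
  filter_upwards [Ioo_mem_nhdsGT (sub_pos.2 hbβ)] with ε hε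
  rw [← Algebra.algebraMap_eq_smul_one, ← spectrum.add_singleton_eq]
  rintro _ ⟨t, ht, _, rfl, rfl⟩
  exact ⟨add_pos_of_nonneg_of_pos (ha ht).1 hε.1, by linarith [hε.2, hmax (.inr ht)]⟩

theorem eventually_spectrum_real_add_smul_one_subset_openInterval (hα : 0 < α)
    (ha : spectrum ℝ a ⊆ leftClosedInterval α) :
    ∀ᶠ ε : ℝ in 𝓝[>] 0, spectrum ℝ (a + ε • 1) ⊆ openInterval α := by
  obtain ⟨β, hβ, -, hev⟩ := exists_eventually_spectrum_real_add_smul_one_subset_Ioc hα ha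
  exact hev.mono fun ε hε => hε.trans (Ioc_zero_subset_openInterval hβ)

theorem tendsto_cfc_add_smul_one (hα : 0 < α) (hf : ContinuousOn f (leftClosedInterval α))
    (ha : IsSelfAdjoint a) (haα : spectrum ℝ a ⊆ leftClosedInterval α) :
    Tendsto (fun ε : ℝ => cfc f (a + ε • 1)) (𝓝[>] 0) (𝓝 (cfc f a)) := by
  obtain ⟨β, hβ, haβ, hev⟩ := exists_eventually_spectrum_real_add_smul_one_subset_Ioc hα haα
  exact (tendsto_add_smul_nhdsGT_zero a 1).cfc isCompact_Icc f
    (hev.mono fun ε hε => hε.trans Ioc_subset_Icc_self)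
    (.of_forall (isSelfAdjoint_add_real_smul ha (.one 𝓐))) haβ ha
    (hf.mono (Icc_zero_subset_leftClosedInterval hβ))

theorem IsMatrixConvex.leftClosedInterval_of_openInterval {n : ℕ} (hα : 0 < α)
    (hf : ContinuousOn f (leftClosedInterval α)) (hconv : IsMatrixConvex n (openInterval α) f) :
    IsMatrixConvex n (leftClosedInterval α) f := by
  intro A B hA hB hAα hBα c hc0 hc1
  have hC := isSelfAdjoint_convexComb hA hB c
  have hCα := spectrum_real_convexComb_subset hA hB (ordConnected_leftClosedInterval α) hAα hBα
    hc0 hc1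
  refine isClosed_setOf_posSemidef.mem_of_tendsto
    ((((tendsto_cfc_add_smul_one hα hf hA hAα).const_smul c).add
      ((tendsto_cfc_add_smul_one hα hf hB hBα).const_smul (1 - c))).sub
      (tendsto_cfc_add_smul_one hα hf hC hCα)) ?_
  filter_upwards [eventually_spectrum_real_add_smul_one_subset_openInterval hα hAα,
    eventually_spectrum_real_add_smul_one_subset_openInterval hα hBα] with ε hAε hBε
  have hshift : c • A + (1 - c) • B + ε • (1 : Matrix (Fin n) (Fin n) ℂ) =
      c • (A + ε • 1) + (1 - c) • (B + ε • 1) := by module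
  rw [hshift]
  exact hconv _ _ (isSelfAdjoint_add_real_smul hA isHermitian_one ε)
    (isSelfAdjoint_add_real_smul hB isHermitian_one ε) hAε hBε c hc0 hc1

end HalfOpenInterval

theorem mainTheorem1_general {m : ℕ} {α : EReal} (hα : 0 < α) {f : ℝ → ℝ}
    (hf : f ∈ classQ (m + 1) (openInterval α)) (hfc : ContinuousOn f (leftClosedInterval α))
    (hmono : IsMatrixMonotone m (openInterval α) fun t => (f t - f 0) / t) :
    IsMatrixConvex m (leftClosedInterval α) f := by
  have hslope : slope f 0 = fun t => (f t - f 0) / t := by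
    simp only [slope_fun_def_field, sub_zero]
  rw [← hslope] at hmono
  have hf0 : ContinuousWithinAt f (Ioi 0) 0 := by
    have h0 := zero_mem_leftClosedInterval hα
    obtain ⟨β, hβ, hβ0⟩ := exists_mem_openInterval_gt h0
    exact (hfc 0 h0).mono_of_mem_nhdsWithin (mem_of_superset (Ioc_mem_nhdsGT hβ0)
      (Ioc_subset_Icc_self.trans (Icc_zero_subset_leftClosedInterval hβ)))
  have hconv : IsMatrixConvex m (openInterval α) f :=
    isMatrixConvex_of_posSemidef_interpolationError (ordConnected_openInterval α)
      fun s hs μ hμ => posSemidef_interpolationError (isOpen_openInterval α) hf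
        (fun h => h.1.false) hf0 hmono hμ.1 (Ioc_zero_subset_openInterval hμ) hs
  exact hconv.leftClosedInterval_of_openInterval hα hfc

theorem mainTheorem1 (n : ℕ) (hn : 2 ≤ n) (α : EReal) (hα : 0 < α) (f : ℝ → ℝ)
    (hf : f ∈ classQ n (leftClosedInterval α)) :
    (IsMatrixMonotone (n - 1) (openInterval α) (fun t => (f t - f 0) / t) →
      IsMatrixConvex (n - 1) (leftClosedInterval α) f) ∧
    (f 0 = 0 → IsMatrixMonotone (n - 1) (openInterval α) (fun t => f t / t) →
      IsMatrixConvex (n - 1) (leftClosedInterval α) f) := by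
  obtain ⟨m, rfl⟩ : ∃ m, n = m + 1 := ⟨n - 1, by omega⟩
  have hQ := classQ_mono (isOpen_openInterval α) (openInterval_subset_leftClosedInterval α) hf
  refine ⟨mainTheorem1_general hα hQ hf.1.continuousOn, fun h0 hmono =>
    mainTheorem1_general hα hQ hf.1.continuousOn ?_⟩
  simpa only [h0, sub_zero] using hmono
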